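/- **Setting.** Let $G$ be a finite graph, possibly with multiple edges but without loops, with vertex set $V(G)$ and edge set $E(G)$; let $E(v)$ be the set of edges incident to a vertex $v$, and let $b:V(G)\to\mathbb{Z}_2$. The group $\Gamma(G,b)$ is generated by $\{x_e : e\in E(G)\}\cup\{J\}$ subject to the relations $J^2=1$ and $x_e^2=1$ for all $e$; $[x_e,J]=1$ for all $e$; $[x_e,x_{e'}]=1$ whenever $e,e'\in E(v)$ for some $v$; and $\prod_{e\in E(v)}x_e=J^{b(v)}$ for all $v\in V(G)$. A *commuting-operator strategy* for $(G,b)$ on a complex Hilbert space $\mathcal H$ consists of a unit vector $\nu\in\mathcal H$ and self-adjoint unitary operators $\mathscr X_{ve},\mathscr Y_{ve}$ on $\mathcal H$ ($v\in V(G)$, $e\in E(v)$) such that $\mathscr X_{ve}$ commutes with $\mathscr X_{vf}$ and $\mathscr Y_{ve}$ commutes with $\mathscr Y_{vf}$ for all $v\in V(G)$ and $e,f\in E(v)$; $\mathscr X_{ve}$ commutes with $\mathscr Y_{uf}$ for all $v,u\in V(G)$, $e\in E(v)$, $f\in E(u)$; and $\prod_{e\in E(v)}\mathscr X_{ve}=\prod_{e\in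 E(v)}\mathscr Y_{ve}=(-1)^{b(v)}\mathbb 1$ for all $v$. It is *perfect* if $\langle\nu|\mathscr X_{ve}\mathscr Y_{ue}\nu\rangle=1$ for all $v,u\in V(G)$ and $e\in E(v)\cap E(u)$. **Statement.** Suppose $\Gamma(G,b)$ is finite, and let $\phi_i:\Gamma(G,b)\to U(\mathcal V_i)$, $i=1,\ldots,k$, be the irreducible unitary representations of $\Gamma(G,b)$ with $\phi_i(J)=-\mathbb 1$ (a complete list, one from each unitary equivalence class). Let $d_i=\dim\mathcal V_i$, choose an orthonormal basis $v_{i1},\ldots,v_{id_i}$ of each $\mathcal V_i$, and let $\phi_i^T$ be the representation of the opposite group $\Gamma(G,b)^{op}$ on $\mathcal V_i$ for which $\phi_i^T(w)$ is the transpose of $\phi_i(w)$ with respect to this basis. If $\{\mathscr X_{ve}\},\{\mathscr Y_{ve}\},\nu$ is a perfect commuting-operator strategy on a Hilbert space $\mathcal H$, then there are a finite-dimensional subspace $\mathcal H_0\subseteq\mathcal H$ which contains $\nu$ and is invariant under all $\mathscr X_{ve}$ and $\mathscr Y_{ve}$ ($v\in V(G)$, $e\in E(v)$), indices $1\le i_1<\cdots<i_m\le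 k$, and an isometric isomorphism $$I:\mathcal H_0\to(\mathcal V_{i_1}\otimes\mathcal V_{i_1})\oplus\cdots\oplus(\mathcal V_{i_m}\otimes\mathcal V_{i_m})$$ such that $$I(\nu)=\sum_{j=1}^m\frac{\lambda_j}{\sqrt{d_{i_j}}}\sum_{\ell=1}^{d_{i_j}}v_{i_j\ell}\otimes v_{i_j\ell}$$ for some positive real numbers $\lambda_j$ with $\sum_j\lambda_j^2=1$, and $$I\,\mathscr X_{ve}|_{\mathcal H_0}\,I^{-1}=\sum_{j=1}^m\phi_{i_j}(x_e)\otimes\mathbb 1_{\mathcal V_{i_j}},\qquad I\,\mathscr Y_{ve}|_{\mathcal H_0}\,I^{-1}=\sum_{j=1}^m\mathbb 1_{\mathcal V_{i_j}}\otimes\phi_{i_j}^T(x_e)$$ for all $v\in V(G)$ and $e\in E(v)$. -/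

import Mathlib

open scoped TensorProduct Graph commutatorElement

/-! ### Graph incidence groups

Graphs are Mathlib's multigraphs `Graph α β`, with vertex set `V(G)`, edge set `E(G)`, and
`G.incidenceSet v` for the set of edges incident to `v`. -/

namespace GraphIncidence

/-- The list `l` runs through all elements of `ι`, each exactly once. -/
def Enumerates {ι : Type*} (l : List ι) : Prop :=
  l.Nodup ∧ ∀ i, i ∈ l

/-- An edge incident to `v`, as an edge of `G`. -/
def incEdge {α β : Type*} (G : Graph α β) (v : α) (e : G.incidenceSet v) : E(G) :=
  ⟨e.1, G.incidenceSet_subset_edgeSet v e.2⟩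

/-- The generators `x_e`, `e ∈ E(G)`, and `J`. -/
inductive Gen {α β : Type*} (G : Graph α β) : Type _
  | x (e : E(G)) : Gen G
  | J : Gen G

/-- The defining relators of the graph incidence group, as elements of the free group on the
generators. In `vertex` every ordering of the edges around `v` is allowed; because
of `comm_vertex` these orderings give equivalent relations. -/
inductive IsRelator {α β : Type*} (G : Graph α β) (b : V(G) → ZMod 2) : FreeGroup (Gen G) → Prop
  | J_sq : IsRelator G b (FreeGroup.of Gen.J ^ 2)
  | x_sq (e : E(G)) : IsRelator G b (FreeGroup.of (Gen.x e) ^ 2)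
  | comm_J (e : E(G)) : IsRelator G b ⁅FreeGroup.of (Gen.x e), FreeGroup.of Gen.J⁆
  | comm_vertex (v : V(G)) (e f : G.incidenceSet v) :
      IsRelator G b
        ⁅FreeGroup.of (Gen.x (incEdge G v e)), FreeGroup.of (Gen.x (incEdge G v f))⁆
  | vertex (v : V(G)) (l : List (G.incidenceSet v)) (hl : Enumerates l) :
      IsRelator G b
        ((l.map fun e => FreeGroup.of (Gen.x (incEdge G v e))).prod *
          (FreeGroup.of Gen.J ^ (b v).val)⁻¹)

/-- The graph incidence group `Γ(G, b)`. -/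
abbrev Gam {α β : Type*} (G : Graph α β) (b : V(G) → ZMod 2) : Type _ :=
  PresentedGroup {r | IsRelator G b r}

/-- The element `x_e` of `Γ(G, b)`. -/
def Gam.x {α β : Type*} (G : Graph α β) (b : V(G) → ZMod 2) (e : E(G)) : Gam G b :=
  PresentedGroup.of (Gen.x e)

/-- The element `J` of `Γ(G, b)`. -/
def Gam.J {α β : Type*} (G : Graph α β) (b : V(G) → ZMod 2) : Gam G b :=
  PresentedGroup.of Gen.J

/-! ### Strategies for the graph incidence game -/

/-- A `{±1}`-valued observable: a self-adjoint unitary operator. -/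
def IsObservable {H : Type*} [NormedAddCommGroup H] [InnerProductSpace ℂ H] [CompleteSpace H]
    (T : H →L[ℂ] H) : Prop :=
  IsSelfAdjoint T ∧ T ∈ unitary (H →L[ℂ] H)

/-- A commuting-operator strategy for the graph incidence game of `(G, b)` on the Hilbert
space `H`. -/
structure CommutingOperatorStrategy {α β : Type*} (G : Graph α β) (b : V(G) → ZMod 2)
    (H : Type*) [NormedAddCommGroup H] [InnerProductSpace ℂ H] [CompleteSpace H] where
  /-- the state -/
  ν : H
  norm_ν : ‖ν‖ = 1
  /-- the first player's observables -/
  X : (v : V(G)) → G.incidenceSet v → H →L[ℂ] H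
  /-- the second player's observables -/
  Y : (v : V(G)) → G.incidenceSet v → H →L[ℂ] H
  isObservable_X : ∀ v e, IsObservable (X v e)
  isObservable_Y : ∀ v e, IsObservable (Y v e)
  commute_X : ∀ v e f, Commute (X v e) (X v f)
  commute_Y : ∀ v e f, Commute (Y v e) (Y v f)
  commute_X_Y : ∀ v e u f, Commute (X v e) (Y u f)
  prod_X : ∀ (v : V(G)) (l : List (G.incidenceSet v)), Enumerates l →
    (l.map (X v)).prod = (-1 : H →L[ℂ] H) ^ (b v).val
  prod_Y : ∀ (v : V(G)) (l : List (G.incidenceSet v)), Enumerates l →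
    (l.map (Y v)).prod = (-1 : H →L[ℂ] H) ^ (b v).val

/-- A strategy is perfect if the two answers for an edge are always perfectly correlated. -/
def CommutingOperatorStrategy.IsPerfect {α β : Type*} {G : Graph α β} {b : V(G) → ZMod 2}
    {H : Type*} [NormedAddCommGroup H] [InnerProductSpace ℂ H] [CompleteSpace H]
    (S : CommutingOperatorStrategy G b H) : Prop :=
  ∀ (v u : V(G)) (e : β) (hv : e ∈ G.incidenceSet v) (hu : e ∈ G.incidenceSet u),
    inner ℂ S.ν (S.X v ⟨e, hv⟩ (S.Y u ⟨e, hu⟩ S.ν)) = 1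

/-! ### Unitary representations -/

/-- Unitary representations `Γ → U(V)`. -/
abbrev UnitaryRep (Γ V : Type*) [Group Γ] [NormedAddCommGroup V] [InnerProductSpace ℂ V] :=
  Γ →* (V ≃ₗᵢ[ℂ] V)

section

variable {Γ V W : Type*} [Group Γ] [NormedAddCommGroup V] [InnerProductSpace ℂ V]
  [NormedAddCommGroup W] [InnerProductSpace ℂ W]

/-- The linear representation underlying a unitary one. -/
def UnitaryRep.toRep (φ : UnitaryRep Γ V) : Representation ℂ Γ V where
  toFun g := (φ g).toLinearEquiv.toLinearMap
  map_one' := by ext; simp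
  map_mul' g h := by ext; simp

/-- Unitary equivalence of unitary representations. -/
def UnitaryRep.Equivalent (φ : UnitaryRep Γ V) (ψ : UnitaryRep Γ W) : Prop :=
  ∃ U : V ≃ₗᵢ[ℂ] W, ∀ (g : Γ) (w : V), U (φ g w) = ψ g (U w)

/-- The transpose of a linear operator with respect to a basis. -/
noncomputable def transpose {n : ℕ} (v : Module.Basis (Fin n) ℂ V) (T : V →ₗ[ℂ] V) :
    V →ₗ[ℂ] V :=
  Matrix.toLin v v (LinearMap.toMatrix v v T).transpose

/-- The representation `φᵀ` of the opposite group, `φᵀ(w) = φ(w)ᵀ`. -/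
noncomputable def UnitaryRep.transposeRep {n : ℕ} (φ : UnitaryRep Γ V)
    (v : OrthonormalBasis (Fin n) ℂ V) : Representation ℂ Γᵐᵒᵖ V where
  toFun w := transpose v.toBasis (φ.toRep w.unop)
  map_one' := by
    simp only [transpose, MulOpposite.unop_one, map_one, LinearMap.toMatrix_one,
      Matrix.transpose_one, Matrix.toLin_one]
    rfl
  map_mul' a b := by
    simp only [transpose, MulOpposite.unop_mul, map_mul, LinearMap.toMatrix_mul,
      Matrix.transpose_mul, Matrix.toLin_mul v.toBasis v.toBasis v.toBasis]
    rfl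

end

/-- `φ 0, …, φ (k - 1)` is the list of the irreducible (finite-dimensional) unitary
representations of `Γ` that send the element `J` to `-1`, one from each equivalence class. -/
structure IsListOfIrreps.{u, w} {Γ : Type u} [Group Γ] (J : Γ) {k : ℕ} (V : Fin k → Type w)
    [∀ i, NormedAddCommGroup (V i)] [∀ i, InnerProductSpace ℂ (V i)]
    (φ : ∀ i, UnitaryRep Γ (V i)) : Prop where
  finiteDimensional : ∀ i, FiniteDimensional ℂ (V i)
  irreducible : ∀ i, (φ i).toRep.IsIrreducible
  map_J : ∀ i (w : V i), φ i J w = -w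
  inequivalent : ∀ i j, i ≠ j → ¬ (φ i).Equivalent (φ j)
  exhaustive : ∀ (W : Type w) [NormedAddCommGroup W] [InnerProductSpace ℂ W]
    [FiniteDimensional ℂ W] (ψ : UnitaryRep Γ W), ψ.toRep.IsIrreducible →
    (∀ w : W, ψ J w = -w) → ∃ i, ψ.Equivalent (φ i)

/-- The canonical maximally entangled state `(1 / √n) ∑ ℓ, v ℓ ⊗ v ℓ`. -/
noncomputable def maxEntangled {V : Type*} [NormedAddCommGroup V] [InnerProductSpace ℂ V]
    {n : ℕ} (v : OrthonormalBasis (Fin n) ℂ V) : V ⊗[ℂ] V :=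
  ((1 / Real.sqrt n : ℝ) : ℂ) • ∑ ℓ, v ℓ ⊗ₜ[ℂ] v ℓ

end GraphIncidence

/-!
The argument rests on three facts about a perfect strategy, whose correlations force `X ν = Y ν` for
the two observables of any edge (`IsPerfect.X_ν_eq_Y_ν`).

*The state generates a representation of `Γ(G, b)`.* Let `H₀` be the span of the orbit of `ν` under
words in the first player's observables. Such a word, applied to `ν`, may be replaced by the reversed
word of the second player, which commutes with every `X`; hence the observables of the two ends of
an edge agree on `H₀`, and they satisfy the relations of `Γ(G, b)` with `J = -1`
(`IsPerfect.exists_rep`). As `Γ(G, b)` is finite, `H₀` is finite-dimensional. On the orbit of `ν` the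
second player's observables act by right translation, and since they are self-adjoint the state
`g ↦ ⟪ν, ρ(g) ν⟫` is a trace (`IsPerfect.inner_rep_mul_comm`).

*A cyclic representation with a tracial vector decomposes without multiplicities.* For an
irreducible `φ` with orthonormal basis `v`, the vectors `t a b = ∑ g, φ(g⁻¹)_{ba} ρ(g) ν` transform
like `v a ⊗ v b`: the left action becomes `φ ⊗ 1` and right translations become `1 ⊗ φᵀ`. By Schur's
lemma and the trace property `⟪ν, t a b⟫` is a multiple of the identity matrix; Schur orthogonality
then shows that the `t a b` of one `φ` are orthogonal and of equal norm, and that those of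
inequivalent representations are orthogonal to each other
(`exists_norm_isotypicVector`, `inner_isotypicVector_of_not_equivalent`).

*These vectors span.* Otherwise the orthogonal complement of their span would contain an
irreducible subspace; testing it against the `t a b` shows that it is orthogonal to `ν`, hence to the
whole orbit (`span_isotypicVector_eq_top`).

Normalizing the nonzero `t a b` therefore gives an orthonormal basis of `H₀`, and the isometry of the
theorem sends it to the product basis of the corresponding blocks. The coordinates of `ν` are
positive multiples of `δ_{ab}`, which is the asserted form of the state
(`exists_isotypic_decomposition`).
-/

namespace GraphIncidence

/-! ### Schur's lemma for unitary representations -/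

section Schur

variable {Γ V W : Type*} [Group Γ] [NormedAddCommGroup V] [InnerProductSpace ℂ V]
  [NormedAddCommGroup W] [InnerProductSpace ℂ W]

@[simp]
theorem UnitaryRep.toRep_apply (φ : UnitaryRep Γ V) (g : Γ) (w : V) : φ.toRep g w = φ g w := rfl

theorem UnitaryRep.mul_apply (φ : UnitaryRep Γ V) (g h : Γ) (x : V) :
    φ (g * h) x = φ g (φ h x) := by
  rw [map_mul]; rfl

theorem UnitaryRep.inner_apply_left (φ : UnitaryRep Γ V) (g : Γ) (x y : V) :
    inner ℂ (φ g x) y = inner ℂ x (φ g⁻¹ y) := by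
  rw [← (φ g⁻¹).inner_map_map (φ g x) y, ← UnitaryRep.mul_apply, inv_mul_cancel, map_one,
    LinearIsometryEquiv.coe_one, id]

/-- **Schur's lemma**: an operator commuting with an irreducible unitary representation is a
scalar. -/
theorem UnitaryRep.exists_eq_smul_of_commute [FiniteDimensional ℂ V] {φ : UnitaryRep Γ V}
    (hφ : φ.toRep.IsIrreducible) (N : V →ₗ[ℂ] V) (hN : ∀ g w, N (φ g w) = φ g (N w)) :
    ∃ c : ℂ, ∀ w, N w = c • w := by
  let F : Representation.IntertwiningMap φ.toRep φ.toRep := ⟨N, fun g => by ext w; exact hN g w⟩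
  obtain ⟨c, hc⟩ :=
    (Representation.IsIrreducible.algebraMap_intertwiningMap_bijective_of_isAlgClosed
      (k := ℂ) (ρ := φ.toRep)).2 F
  refine ⟨c, fun w => ?_⟩
  have := congrArg (fun F : Representation.IntertwiningMap φ.toRep φ.toRep => F w) hc
  exact this.symm

/-- A nonzero intertwiner `N` between irreducible unitary representations can be rescaled to a
unitary one, because `N† N` is a scalar by Schur's lemma. -/
theorem UnitaryRep.equivalent_of_intertwiner [FiniteDimensional ℂ V] [FiniteDimensional ℂ W]
    {φ : UnitaryRep Γ V} {ψ : UnitaryRep Γ W} (hφ : φ.toRep.IsIrreducible)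
    (hψ : ψ.toRep.IsIrreducible) (N : V →ₗ[ℂ] W) (hN : ∀ g w, N (φ g w) = ψ g (N w))
    (hN0 : N ≠ 0) : φ.Equivalent ψ := by
  let F : Representation.IntertwiningMap φ.toRep ψ.toRep := ⟨N, fun g => by ext w; exact hN g w⟩
  have hbij : Function.Bijective N := by
    refine (Representation.IsIrreducible.bijective_or_eq_zero F).resolve_right fun h => hN0 ?_
    ext w
    exact congrArg (fun F : Representation.IntertwiningMap φ.toRep ψ.toRep => F w) h
  obtain ⟨c, hc⟩ := UnitaryRep.exists_eq_smul_of_commute hφ (N.adjoint ∘ₗ N) (by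
    intro g w
    refine ext_inner_left ℂ fun x => ?_
    rw [LinearMap.comp_apply, LinearMap.adjoint_inner_right, hN, ← inv_inv g,
      ← UnitaryRep.inner_apply_left, ← UnitaryRep.inner_apply_left, LinearMap.comp_apply,
      LinearMap.adjoint_inner_right, hN])
  have hnorm : ∀ w, (‖N w‖ : ℂ) ^ 2 = c * (‖w‖ : ℂ) ^ 2 := by
    intro w
    have h1 : inner ℂ w ((N.adjoint ∘ₗ N) w) = c * inner ℂ w w := by rw [hc, inner_smul_right]
    rw [LinearMap.comp_apply, LinearMap.adjoint_inner_right, inner_self_eq_norm_sq_to_K,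
      inner_self_eq_norm_sq_to_K] at h1
    exact h1
  obtain ⟨w₀, hw₀⟩ : ∃ w, N w ≠ 0 := by
    by_contra! h
    exact hN0 (LinearMap.ext h)
  have hw₀' : w₀ ≠ 0 := fun h => hw₀ (by rw [h, map_zero])
  have hr : 0 < ‖N w₀‖ / ‖w₀‖ := div_pos (norm_pos_iff.2 hw₀) (norm_pos_iff.2 hw₀')
  set r := ‖N w₀‖ / ‖w₀‖ with hrdef
  have hcr : c = ((r ^ 2 : ℝ) : ℂ) := by
    have h := hnorm w₀
    have h0 : (‖w₀‖ : ℂ) ≠ 0 := by exact_mod_cast norm_ne_zero_iff.2 hw₀'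
    rw [hrdef]; push_cast; field_simp; exact h.symm
  have hnorm' : ∀ w, ‖N w‖ = r * ‖w‖ := by
    intro w
    have h := hnorm w
    rw [hcr] at h
    have h' : ‖N w‖ ^ 2 = (r * ‖w‖) ^ 2 := by rw [mul_pow]; exact_mod_cast h
    exact (pow_left_inj₀ (norm_nonneg _) (by positivity) two_ne_zero).1 h'
  have hrc : ((r⁻¹ : ℝ) : ℂ) ≠ 0 := by exact_mod_cast (inv_pos.2 hr).ne'
  let U : V →ₗᵢ[ℂ] W := ⟨((r⁻¹ : ℝ) : ℂ) • N, fun w => by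
    rw [LinearMap.smul_apply, norm_smul, hnorm', Complex.norm_real, Real.norm_eq_abs,
      abs_of_pos (inv_pos.2 hr), inv_mul_cancel_left₀ hr.ne']⟩
  have hU : Function.Surjective U := by
    intro y
    obtain ⟨x, rfl⟩ := hbij.2 y
    refine ⟨((r⁻¹ : ℝ) : ℂ)⁻¹ • x, ?_⟩
    change ((r⁻¹ : ℝ) : ℂ) • N (((r⁻¹ : ℝ) : ℂ)⁻¹ • x) = N x
    rw [map_smul, smul_inv_smul₀ hrc]
  refine ⟨LinearIsometryEquiv.ofSurjective U hU, fun g w => ?_⟩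
  change ((r⁻¹ : ℝ) : ℂ) • N (φ g w) = ψ g (((r⁻¹ : ℝ) : ℂ) • N w)
  rw [hN, map_smul]

end Schur

/-! ### Matrix coefficients and Schur orthogonality -/

section Coefficients

variable {Γ V W : Type*} [Group Γ] [NormedAddCommGroup V] [InnerProductSpace ℂ V]
  [NormedAddCommGroup W] [InnerProductSpace ℂ W] {n m : ℕ}

/-- The matrix coefficient `⟨v a, φ(g) (v b)⟩`. -/
noncomputable def UnitaryRep.coeff (φ : UnitaryRep Γ V) (v : OrthonormalBasis (Fin n) ℂ V) (g : Γ)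
    (a b : Fin n) : ℂ :=
  inner ℂ (v a) (φ g (v b))

variable (φ : UnitaryRep Γ V) (v : OrthonormalBasis (Fin n) ℂ V)

theorem UnitaryRep.apply_basis (g : Γ) (b : Fin n) :
    φ g (v b) = ∑ a, φ.coeff v g a b • v a :=
  (v.sum_repr' _).symm

theorem UnitaryRep.coeff_mul (g h : Γ) (a b : Fin n) :
    φ.coeff v (g * h) a b = ∑ c, φ.coeff v g a c * φ.coeff v h c b := by
  rw [UnitaryRep.coeff, UnitaryRep.mul_apply, φ.apply_basis v h, map_sum, inner_sum]
  refine Finset.sum_congr rfl fun c _ => ?_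
  rw [map_smul, inner_smul_right, mul_comm]; rfl

theorem UnitaryRep.coeff_one (a b : Fin n) :
    φ.coeff v 1 a b = if a = b then 1 else 0 := by
  rw [UnitaryRep.coeff, map_one, LinearIsometryEquiv.coe_one, id, v.inner_eq_ite]

theorem UnitaryRep.star_coeff_inv (g : Γ) (a b : Fin n) :
    (starRingEnd ℂ) (φ.coeff v g⁻¹ a b) = φ.coeff v g b a := by
  rw [UnitaryRep.coeff, inner_conj_symm, UnitaryRep.inner_apply_left, inv_inv, UnitaryRep.coeff]

theorem UnitaryRep.sum_coeff_inv_mul_coeff (g : Γ) (b d : Fin n) :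
    ∑ a, φ.coeff v g⁻¹ b a * φ.coeff v g a d = if b = d then 1 else 0 := by
  rw [← UnitaryRep.coeff_mul, inv_mul_cancel, UnitaryRep.coeff_one]

variable [Fintype Γ] (ψ : UnitaryRep Γ W) (w : OrthonormalBasis (Fin m) ℂ W)

/-- The average over the group of the rank-one operator `|v b⟩⟨w d|`, an intertwiner from `ψ` to
`φ`. Its matrix entries are the sums in the Schur orthogonality relations. -/
noncomputable def avgRankOne (b : Fin n) (d : Fin m) : W →ₗ[ℂ] V :=
  ∑ g : Γ, (φ.toRep g) ∘ₗ ((innerₛₗ ℂ (w d)).smulRight (v b)) ∘ₗ (ψ.toRep g⁻¹)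

theorem avgRankOne_apply (b : Fin n) (d : Fin m) (y : W) :
    avgRankOne φ v ψ w b d y = ∑ g : Γ, inner ℂ (w d) (ψ g⁻¹ y) • φ g (v b) := by
  simp [avgRankOne, LinearMap.sum_apply]

theorem avgRankOne_comm (b : Fin n) (d : Fin m) (h : Γ) (y : W) :
    avgRankOne φ v ψ w b d (ψ h y) = φ h (avgRankOne φ v ψ w b d y) := by
  rw [avgRankOne_apply, avgRankOne_apply, map_sum,
    ← Equiv.sum_comp (Equiv.mulLeft h) (fun g : Γ => inner ℂ (w d) (ψ g⁻¹ (ψ h y)) • φ g (v b))]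
  refine Finset.sum_congr rfl fun g _ => ?_
  rw [Equiv.coe_mulLeft, map_smul, ← UnitaryRep.mul_apply, ← UnitaryRep.mul_apply]
  simp

theorem inner_avgRankOne (a b : Fin n) (c d : Fin m) :
    inner ℂ (v a) (avgRankOne φ v ψ w b d (w c)) =
      ∑ g : Γ, φ.coeff v g a b * ψ.coeff w g⁻¹ d c := by
  rw [avgRankOne_apply, inner_sum]
  refine Finset.sum_congr rfl fun g _ => ?_
  rw [inner_smul_right, mul_comm]; rfl

/-- Schur orthogonality for inequivalent irreducible representations. -/
theorem sum_coeff_mul_coeff_inv_of_not_equivalent (hφ : φ.toRep.IsIrreducible)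
    (hψ : ψ.toRep.IsIrreducible) (h : ¬ ψ.Equivalent φ) (a b : Fin n) (c d : Fin m) :
    ∑ g : Γ, φ.coeff v g a b * ψ.coeff w g⁻¹ d c = 0 := by
  have : FiniteDimensional ℂ V := v.toBasis.finiteDimensional_of_finite
  have : FiniteDimensional ℂ W := w.toBasis.finiteDimensional_of_finite
  rw [← inner_avgRankOne]
  by_cases h0 : avgRankOne φ v ψ w b d = 0
  · rw [h0, LinearMap.zero_apply, inner_zero_right]
  · exact absurd (UnitaryRep.equivalent_of_intertwiner hψ hφ _ (avgRankOne_comm φ v ψ w b d) h0) h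

/-- Schur orthogonality for the coefficients of a single irreducible representation. -/
theorem sum_coeff_mul_coeff_inv (hφ : φ.toRep.IsIrreducible) (a b c d : Fin n) :
    ∑ g : Γ, φ.coeff v g a b * φ.coeff v g⁻¹ d c =
      if a = c ∧ b = d then (Fintype.card Γ : ℂ) / n else 0 := by
  have : FiniteDimensional ℂ V := v.toBasis.finiteDimensional_of_finite
  obtain ⟨r, hr⟩ := UnitaryRep.exists_eq_smul_of_commute hφ _ (avgRankOne_comm φ v φ v b d)
  have hn : (n : ℂ) ≠ 0 := by
    have : 0 < n := a.pos
    exact_mod_cast this.ne'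
  have key : ∀ a c, ∑ g : Γ, φ.coeff v g a b * φ.coeff v g⁻¹ d c = if a = c then r else 0 := by
    intro a c
    rw [← inner_avgRankOne, hr, inner_smul_right, v.inner_eq_ite]
    split_ifs <;> simp
  -- The scalar is found by taking the trace.
  have htr : (n : ℂ) * r = if b = d then (Fintype.card Γ : ℂ) else 0 := by
    have h1 : ∑ c : Fin n, ∑ g : Γ, φ.coeff v g c b * φ.coeff v g⁻¹ d c = n * r := by
      simp [key]
    rw [← h1, Finset.sum_comm]
    simp_rw [mul_comm (φ.coeff v _ _ b), φ.sum_coeff_inv_mul_coeff v, eq_comm (a := d)]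
    split_ifs <;> simp
  rw [key]
  by_cases hac : a = c <;> by_cases hbd : b = d <;> simp_all [eq_div_iff, mul_comm]

end Coefficients

/-! ### Irreducible subspaces -/

section Subrepresentations

variable {Γ V K : Type*} [Group Γ] [NormedAddCommGroup V] [InnerProductSpace ℂ V]
  [NormedAddCommGroup K] [InnerProductSpace ℂ K]

theorem UnitaryRep.isIrreducible_of_forall_submodule [Nontrivial V] (φ : UnitaryRep Γ V)
    (h : ∀ N : Submodule ℂ V, (∀ g, ∀ w ∈ N, φ g w ∈ N) → N = ⊥ ∨ N = ⊤) :
    φ.toRep.IsIrreducible := by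
  refine @IsSimpleOrder.mk _ _ _ ⟨⊥, ⊤, fun hbt => ?_⟩ fun σ => ?_
  · exact bot_ne_top (α := Submodule ℂ V) (congrArg Subrepresentation.toSubmodule hbt)
  · exact (h σ.toSubmodule fun g w hw => σ.apply_mem_toSubmodule g hw).imp
      (fun h => Subrepresentation.toSubmodule_injective h)
      (fun h => Subrepresentation.toSubmodule_injective h)

theorem UnitaryRep.nontrivial_of_isIrreducible {φ : UnitaryRep Γ V} (h : φ.toRep.IsIrreducible) :
    Nontrivial V := by
  by_contra hV
  rw [not_nontrivial_iff_subsingleton] at hV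
  obtain ⟨σ, τ, hστ⟩ := h.toNontrivial
  exact hστ (Subrepresentation.toSubmodule_injective (Subsingleton.elim _ _))

/-- The restriction of a unitary representation to an invariant subspace `N`, transported along an
isometry of `N` with `E`. -/
noncomputable def UnitaryRep.restrictTransport (ρ : UnitaryRep Γ K) (N : Submodule ℂ K)
    (hN : ∀ g, ∀ w ∈ N, ρ g w ∈ N) (e : V ≃ₗᵢ[ℂ] N) : UnitaryRep Γ V where
  toFun g :=
    { toFun := fun x => e.symm ⟨ρ g (e x), hN g _ (e x).2⟩
      invFun := fun x => e.symm ⟨ρ g⁻¹ (e x), hN g⁻¹ _ (e x).2⟩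
      map_add' := fun x y => by
        rw [← map_add]; congr 1; ext; simp
      map_smul' := fun c x => by
        rw [RingHom.id_apply, ← map_smul]; congr 1; ext; simp
      left_inv := fun x => by simp
      right_inv := fun x => by simp
      norm_map' := fun x => by
        change ‖e.symm ⟨ρ g (e x), hN g _ (e x).2⟩‖ = ‖x‖
        rw [LinearIsometryEquiv.norm_map]
        change ‖ρ g (e x)‖ = ‖x‖
        rw [LinearIsometryEquiv.norm_map, ← Submodule.coe_norm, LinearIsometryEquiv.norm_map] }
  map_one' := by ext x; simp
  map_mul' g h := by
    ext x
    change e.symm _ = e.symm _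
    congr 1
    ext
    simp

theorem UnitaryRep.coe_restrictTransport (ρ : UnitaryRep Γ K) (N : Submodule ℂ K)
    (hN : ∀ g, ∀ w ∈ N, ρ g w ∈ N) (e : V ≃ₗᵢ[ℂ] N) (g : Γ) (x : V) :
    (e (ρ.restrictTransport N hN e g x) : K) = ρ g (e x) := by
  change (e (e.symm ⟨ρ g (e x), hN g _ (e x).2⟩) : K) = _
  simp

/-- Every nonzero invariant subspace contains an irreducible one. The latter is given as the image
of an equivariant isometry from a Euclidean space in a prescribed universe. -/
theorem UnitaryRep.exists_irreducible_le.{w} [FiniteDimensional ℂ K] (ρ : UnitaryRep Γ K)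
    (N : Submodule ℂ K) (hN : ∀ g, ∀ w ∈ N, ρ g w ∈ N) (hN0 : N ≠ ⊥) :
    ∃ (n : ℕ) (ψ : UnitaryRep Γ (EuclideanSpace ℂ (ULift.{w} (Fin n))))
      (f : EuclideanSpace ℂ (ULift.{w} (Fin n)) →ₗᵢ[ℂ] K),
      ψ.toRep.IsIrreducible ∧ (∀ g x, f (ψ g x) = ρ g (f x)) ∧ ∀ x, f x ∈ N := by
  obtain ⟨W, ⟨hW, hWN, hW0⟩, hmin⟩ := (wellFounded_lt (α := Submodule ℂ K)).has_min
    {W | (∀ g, ∀ w ∈ W, ρ g w ∈ W) ∧ W ≤ N ∧ W ≠ ⊥} ⟨N, hN, le_rfl, hN0⟩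
  let e : EuclideanSpace ℂ (ULift.{w} (Fin (Module.finrank ℂ W))) ≃ₗᵢ[ℂ] W :=
    ((stdOrthonormalBasis ℂ W).reindex Equiv.ulift.symm).repr.symm
  let f := W.subtypeₗᵢ.comp e.toLinearIsometry
  have hfW : ∀ x, f x ∈ W := fun x => (e x).2
  have hf : ∀ g x, f (ρ.restrictTransport W hW e g x) = ρ g (f x) :=
    ρ.coe_restrictTransport W hW e
  have : Nontrivial W := Submodule.nontrivial_iff_ne_bot.2 hW0
  have : Nontrivial (EuclideanSpace ℂ (ULift.{w} (Fin (Module.finrank ℂ W)))) :=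
    e.toEquiv.nontrivial
  refine ⟨_, ρ.restrictTransport W hW e, f, ?_, hf, fun x => hWN (hfW x)⟩
  refine UnitaryRep.isIrreducible_of_forall_submodule _ fun M hM => ?_
  by_cases hM0 : M = ⊥
  · exact Or.inl hM0
  refine Or.inr ?_
  have hle : M.map f.toLinearMap ≤ W := by
    rintro _ ⟨x, -, rfl⟩
    exact hfW x
  have hnlt : ¬ M.map f.toLinearMap < W := hmin _ ⟨?_, hle.trans hWN, ?_⟩
  · have heq := hle.eq_of_not_lt hnlt
    rw [eq_top_iff]
    intro x _
    obtain ⟨y, hy, hyx⟩ := heq.ge (hfW x)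
    rwa [← f.injective hyx]
  · rintro g _ ⟨x, hx, rfl⟩
    exact ⟨_, hM g x hx, hf g x⟩
  · exact fun h => hM0 (Submodule.map_injective_of_injective (f := f.toLinearMap) f.injective
      (h.trans (Submodule.map_bot _).symm))

end Subrepresentations

/-! ### Isotypic vectors of a tracial state -/

section Isotypic

variable {Γ V W K : Type*} [Group Γ] [Fintype Γ] [NormedAddCommGroup V] [InnerProductSpace ℂ V]
  [NormedAddCommGroup W] [InnerProductSpace ℂ W]
  [NormedAddCommGroup K] [InnerProductSpace ℂ K] {n m : ℕ}

/-- The vector `∑ g, φ(g⁻¹)_{ba} ρ(g) ν`. Up to a normalization these are the images of `v a ⊗ v b`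
under an embedding of `V ⊗ V` that is equivariant on both sides. -/
noncomputable def isotypicVector (φ : UnitaryRep Γ V) (v : OrthonormalBasis (Fin n) ℂ V)
    (ρ : UnitaryRep Γ K) (ν : K) (a b : Fin n) : K :=
  ∑ g : Γ, φ.coeff v g⁻¹ b a • ρ g ν

variable (φ : UnitaryRep Γ V) (v : OrthonormalBasis (Fin n) ℂ V)
  (ψ : UnitaryRep Γ W) (w : OrthonormalBasis (Fin m) ℂ W) (ρ : UnitaryRep Γ K) (ν : K)

/-- On the first index, isotypic vectors transform under `ρ` as the basis `v` does under `φ`. -/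
theorem rep_isotypicVector (h : Γ) (a b : Fin n) :
    ρ h (isotypicVector φ v ρ ν a b) = ∑ c, φ.coeff v h c a • isotypicVector φ v ρ ν c b := by
  simp only [isotypicVector, map_sum, Finset.smul_sum, smul_smul, map_smul]
  rw [Finset.sum_comm, ← Equiv.sum_comp (Equiv.mulLeft h) (fun g : Γ => ∑ c : Fin n, _)]
  refine Finset.sum_congr rfl fun g _ => ?_
  rw [← Finset.sum_smul, Equiv.coe_mulLeft, ← UnitaryRep.mul_apply]
  congr 1
  simp_rw [mul_comm (φ.coeff v h _ a)]
  rw [← UnitaryRep.coeff_mul]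
  simp

/-- On the second index, isotypic vectors transform under right translation of the orbit of `ν` by
the transpose of `φ`. -/
theorem right_isotypicVector {x : Γ} {R : K →ₗ[ℂ] K} (hR : ∀ g, R (ρ g ν) = ρ (g * x) ν)
    (a b : Fin n) :
    R (isotypicVector φ v ρ ν a b) = ∑ c, φ.coeff v x b c • isotypicVector φ v ρ ν a c := by
  simp only [isotypicVector, map_sum, Finset.smul_sum, smul_smul, map_smul, hR]
  rw [Finset.sum_comm, ← Equiv.sum_comp (Equiv.mulRight x) (fun g : Γ => ∑ c : Fin n, _)]
  refine Finset.sum_congr rfl fun g _ => ?_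
  rw [← Finset.sum_smul, Equiv.coe_mulRight, ← UnitaryRep.coeff_mul]
  simp

variable {φ ρ ν}

/-- For a tracial vector state, the operator `∑ g, ⟪ν, ρ(g) ν⟫ φ(g⁻¹)` commutes with `φ`, hence is a
scalar. -/
theorem exists_inner_isotypicVector (hφ : φ.toRep.IsIrreducible)
    (hν : ∀ g h, inner ℂ ν (ρ (g * h) ν) = inner ℂ ν (ρ (h * g) ν)) :
    ∃ s : ℂ, ∀ a b, inner ℂ ν (isotypicVector φ v ρ ν a b) = if a = b then s else 0 := by
  have : FiniteDimensional ℂ V := v.toBasis.finiteDimensional_of_finite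
  let N : V →ₗ[ℂ] V := ∑ g : Γ, (inner ℂ ν (ρ g ν) : ℂ) • φ.toRep g⁻¹
  have hN : ∀ y, N y = ∑ g : Γ, (inner ℂ ν (ρ g ν) : ℂ) • φ g⁻¹ y := fun y => by
    simp [N, LinearMap.sum_apply]
  obtain ⟨s, hs⟩ := UnitaryRep.exists_eq_smul_of_commute hφ N (by
    intro h y
    rw [hN, hN, map_sum,
      ← Equiv.sum_comp (MulAut.conj h).toEquiv (fun g : Γ => _ • φ g⁻¹ (φ h y))]
    refine Finset.sum_congr rfl fun g _ => ?_
    have h1 : inner ℂ ν (ρ (h * g * h⁻¹) ν) = inner ℂ ν (ρ g ν) := by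
      rw [hν, inv_mul_cancel_left]
    have h2 : φ (h * g * h⁻¹)⁻¹ (φ h y) = φ h (φ g⁻¹ y) := by
      rw [← UnitaryRep.mul_apply, ← UnitaryRep.mul_apply]
      congr 2
      group
    rw [map_smul, ← h1, ← h2]
    rfl)
  refine ⟨s, fun a b => ?_⟩
  have h1 : inner ℂ (v b) (N (v a)) = if a = b then s else 0 := by
    rw [hs, inner_smul_right, v.inner_eq_ite]
    simp [eq_comm]
  rw [← h1, hN, isotypicVector, inner_sum, inner_sum]
  refine Finset.sum_congr rfl fun g _ => ?_
  rw [inner_smul_right, inner_smul_right, mul_comm, UnitaryRep.coeff]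

/-- Once the inner products with `ν` are known, those among isotypic vectors reduce to the sums in
the Schur orthogonality relations. -/
theorem inner_isotypicVector {s : ℂ}
    (hs : ∀ a b, inner ℂ ν (isotypicVector ψ w ρ ν a b) = if a = b then s else 0)
    (a b : Fin n) (c d : Fin m) :
    inner ℂ (isotypicVector φ v ρ ν a b) (isotypicVector ψ w ρ ν c d) =
      s * ∑ g : Γ, φ.coeff v g a b * ψ.coeff w g⁻¹ d c := by
  rw [isotypicVector, sum_inner, Finset.mul_sum]
  refine Finset.sum_congr rfl fun g _ => ?_
  rw [inner_smul_left, UnitaryRep.star_coeff_inv, UnitaryRep.inner_apply_left, rep_isotypicVector,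
    inner_sum]
  simp_rw [inner_smul_right, hs]
  simp
  ring

/-- The isotypic vectors of an irreducible representation are orthogonal, of a common norm `r`, and
their inner products with `ν` are determined by `r`. -/
theorem exists_norm_isotypicVector (hφ : φ.toRep.IsIrreducible)
    (hν : ∀ g h, inner ℂ ν (ρ (g * h) ν) = inner ℂ ν (ρ (h * g) ν)) :
    ∃ r : ℝ, 0 ≤ r ∧
      (∀ a b c d, inner ℂ (isotypicVector φ v ρ ν a b) (isotypicVector φ v ρ ν c d) =
        if a = c ∧ b = d then ((r ^ 2 : ℝ) : ℂ) else 0) ∧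
      ∀ a b, inner ℂ (isotypicVector φ v ρ ν a b) ν =
        if a = b then ((r ^ 2 * n / Fintype.card Γ : ℝ) : ℂ) else 0 := by
  obtain ⟨s, hs⟩ := exists_inner_isotypicVector v hφ hν
  rcases Nat.eq_zero_or_pos n with rfl | hn
  · exact ⟨0, le_rfl, fun a => a.elim0, fun a => a.elim0⟩
  have hΓ : (Fintype.card Γ : ℂ) ≠ 0 := by exact_mod_cast Fintype.card_ne_zero
  have hn' : (n : ℂ) ≠ 0 := by exact_mod_cast hn.ne'
  have hin := inner_isotypicVector (φ := φ) v φ v hs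
  simp_rw [sum_coeff_mul_coeff_inv φ v hφ] at hin
  set t := isotypicVector φ v ρ ν
  have hr : s * (Fintype.card Γ / n) = ((‖t ⟨0, hn⟩ ⟨0, hn⟩‖ ^ 2 : ℝ) : ℂ) := by
    have h := hin ⟨0, hn⟩ ⟨0, hn⟩ ⟨0, hn⟩ ⟨0, hn⟩
    rw [inner_self_eq_norm_sq_to_K, if_pos ⟨rfl, rfl⟩] at h
    rw [← h]
    push_cast
    rfl
  refine ⟨‖t ⟨0, hn⟩ ⟨0, hn⟩‖, norm_nonneg _, fun a b c d => ?_, fun a b => ?_⟩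
  · rw [hin, ← hr, mul_ite, mul_zero]
  · have hsr : s = ((‖t ⟨0, hn⟩ ⟨0, hn⟩‖ ^ 2 * n / Fintype.card Γ : ℝ) : ℂ) := by
      push_cast at hr ⊢
      rw [← hr]
      field_simp
    rw [← inner_conj_symm, hs, ← hsr]
    split_ifs
    · rw [hsr, Complex.conj_ofReal]
    · simp

theorem inner_isotypicVector_of_not_equivalent (hφ : φ.toRep.IsIrreducible)
    (hψ : ψ.toRep.IsIrreducible) (h : ¬ ψ.Equivalent φ)
    (hν : ∀ g h, inner ℂ ν (ρ (g * h) ν) = inner ℂ ν (ρ (h * g) ν))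
    (a b : Fin n) (c d : Fin m) :
    inner ℂ (isotypicVector φ v ρ ν a b) (isotypicVector ψ w ρ ν c d) = 0 := by
  obtain ⟨s, hs⟩ := exists_inner_isotypicVector w hψ hν
  rw [inner_isotypicVector v ψ w hs,
    sum_coeff_mul_coeff_inv_of_not_equivalent φ v ψ w hφ hψ h, mul_zero]

/-- An equivariant map `f : V → K` whose image is orthogonal to all isotypic vectors of `V` has
image orthogonal to `ν`: the sum over `a` of `⟪f (v a), ∑ g, φ(g⁻¹)_{ba} ρ(g) ν⟫` is
`|Γ| ⟪f (v b), ν⟫`. -/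
theorem inner_eq_zero_of_forall_isotypicVector (f : V →ₗ[ℂ] K)
    (hf : ∀ g x, f (φ g x) = ρ g (f x))
    (h : ∀ x a b, inner ℂ (f x) (isotypicVector φ v ρ ν a b) = 0) (x : V) :
    inner ℂ (f x) ν = 0 := by
  have key : ∀ g c, inner ℂ (f (v c)) (ρ g ν) =
      ∑ e, φ.coeff v g c e * inner ℂ (f (v e)) ν := by
    intro g c
    rw [← inv_inv g, ← UnitaryRep.inner_apply_left, ← hf, UnitaryRep.apply_basis _ v, map_sum,
      sum_inner, inv_inv]
    simp_rw [map_smul, inner_smul_left, UnitaryRep.star_coeff_inv]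
  have hb : ∀ b, inner ℂ (f (v b)) ν = 0 := by
    intro b
    have h1 : ∑ a, inner ℂ (f (v a)) (isotypicVector φ v ρ ν a b) =
        (Fintype.card Γ : ℂ) * inner ℂ (f (v b)) ν := by
      simp_rw [isotypicVector, inner_sum, inner_smul_right, key, Finset.mul_sum, ← mul_assoc]
      rw [Finset.sum_comm]
      have h2 : ∀ g : Γ, ∑ a, ∑ e, φ.coeff v g⁻¹ b a * φ.coeff v g a e * inner ℂ (f (v e)) ν =
          inner ℂ (f (v b)) ν := by
        intro g
        rw [Finset.sum_comm]
        simp_rw [← Finset.sum_mul, UnitaryRep.sum_coeff_inv_mul_coeff]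
        simp
      simp_rw [h2]
      simp
    simp_rw [h, Finset.sum_const_zero] at h1
    exact (mul_eq_zero.1 h1.symm).resolve_left (by exact_mod_cast Fintype.card_ne_zero)
  rw [← v.sum_repr' x, map_sum, sum_inner]
  refine Finset.sum_eq_zero fun b _ => ?_
  rw [map_smul, inner_smul_left, hb, mul_zero]

end Isotypic

/-! ### Isotypic vectors span a cyclic representation -/

section Span

universe w

variable {Γ K : Type*} [Group Γ] [Fintype Γ] [NormedAddCommGroup K] [InnerProductSpace ℂ K]
  [FiniteDimensional ℂ K]

/-- If `ν` is cyclic, the isotypic vectors span. Otherwise the orthogonal complement of their span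
contains an irreducible subspace, which is orthogonal to `ν`, hence to everything. -/
theorem span_isotypicVector_eq_top {J : Γ} {k : ℕ} {V : Fin k → Type w}
    [∀ i, NormedAddCommGroup (V i)] [∀ i, InnerProductSpace ℂ (V i)]
    {φ : ∀ i, UnitaryRep Γ (V i)} (hφ : IsListOfIrreps J V φ)
    {d : Fin k → ℕ} (v : ∀ i, OrthonormalBasis (Fin (d i)) ℂ (V i))
    {ρ : UnitaryRep Γ K} (hJ : ∀ y, ρ J y = -y) {ν : K}
    (hcyc : Submodule.span ℂ (Set.range fun g => ρ g ν) = ⊤) :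
    Submodule.span ℂ (Set.range fun p : Σ i, Fin (d i) × Fin (d i) =>
      isotypicVector (φ p.1) (v p.1) ρ ν p.2.1 p.2.2) = ⊤ := by
  set M := Submodule.span ℂ (Set.range fun p : Σ i, Fin (d i) × Fin (d i) =>
      isotypicVector (φ p.1) (v p.1) ρ ν p.2.1 p.2.2)
  have hmem : ∀ i a b, isotypicVector (φ i) (v i) ρ ν a b ∈ M := fun i a b =>
    Submodule.subset_span ⟨⟨i, a, b⟩, rfl⟩
  have hinv : ∀ g, ∀ y ∈ M, ρ g y ∈ M := by
    intro g y hy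
    induction hy using Submodule.span_induction with
    | mem y hy =>
      obtain ⟨⟨i, a, b⟩, rfl⟩ := hy
      change ρ g (isotypicVector (φ i) (v i) ρ ν a b) ∈ M
      rw [rep_isotypicVector]
      exact M.sum_mem fun c _ => M.smul_mem _ (hmem i c b)
    | zero => rw [map_zero]; exact M.zero_mem
    | add x y _ _ hx hy => rw [map_add]; exact M.add_mem hx hy
    | smul c x _ hx => rw [map_smul]; exact M.smul_mem c hx
  by_contra hne
  have hinv' : ∀ g, ∀ y ∈ Mᗮ, ρ g y ∈ Mᗮ := by
    intro g y hy
    rw [Submodule.mem_orthogonal'] at hy ⊢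
    intro x hx
    rw [UnitaryRep.inner_apply_left]
    exact hy _ (hinv _ _ hx)
  obtain ⟨n, ψ, f, hψ, hf, hfM⟩ := UnitaryRep.exists_irreducible_le (Γ := Γ) ρ Mᗮ hinv'
    fun h => hne (Submodule.orthogonal_eq_bot_iff.1 h)
  obtain ⟨i, U, hU⟩ := hφ.exhaustive _ ψ hψ fun x => f.injective (by rw [hf, hJ, map_neg])
  have h0 : ∀ x, inner ℂ (f x) ν = 0 := by
    intro x
    have h := inner_eq_zero_of_forall_isotypicVector (φ := φ i) (v i) (ρ := ρ) (ν := ν)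
      (f.toLinearMap ∘ₗ U.symm.toLinearEquiv.toLinearMap) (fun g y => ?_) (fun y a b => ?_) (U x)
    · simpa using h
    · change f (U.symm (φ i g y)) = ρ g (f (U.symm y))
      rw [← hf]
      congr 1
      rw [LinearIsometryEquiv.symm_apply_eq, hU, LinearIsometryEquiv.apply_symm_apply]
    · exact (Submodule.mem_orthogonal' _ _).1 (hfM _) _ (hmem i a b)
  have h1 : ∀ x, f x = 0 := by
    intro x
    refine inner_self_eq_zero (𝕜 := ℂ).1 ?_
    have hx : f x ∈ Submodule.span ℂ (Set.range fun g => ρ g ν) := hcyc ▸ Submodule.mem_top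
    have hall : ∀ y ∈ Submodule.span ℂ (Set.range fun g => ρ g ν), inner ℂ (f x) y = 0 := by
      intro y hy
      induction hy using Submodule.span_induction with
      | mem y hy =>
        obtain ⟨g, rfl⟩ := hy
        change inner ℂ (f x) (ρ g ν) = 0
        rw [← inv_inv g, ← UnitaryRep.inner_apply_left, ← hf, h0]
      | zero => rw [inner_zero_right]
      | add y z _ _ hy hz => rw [inner_add_right, hy, hz, add_zero]
      | smul c y _ hy => rw [inner_smul_right, hy, mul_zero]
    exact hall _ hx
  obtain ⟨x, hx⟩ := @exists_ne _ (UnitaryRep.nontrivial_of_isIrreducible hψ) 0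
  exact hx (f.injective (by rw [h1, map_zero]))

end Span

/-! ### Maximally entangled states and transposes -/

section MaxEntangled

variable {Γ V : Type*} [Group Γ] [NormedAddCommGroup V] [InnerProductSpace ℂ V] {n : ℕ}

theorem norm_maxEntangled (v : OrthonormalBasis (Fin n) ℂ V) (hn : 0 < n) :
    ‖maxEntangled v‖ = 1 := by
  have h1 : ‖∑ ℓ, v ℓ ⊗ₜ[ℂ] v ℓ‖ ^ 2 = (n : ℝ) := by
    have h : inner ℂ (∑ ℓ, v ℓ ⊗ₜ[ℂ] v ℓ) (∑ ℓ, v ℓ ⊗ₜ[ℂ] v ℓ) = (n : ℂ) := by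
      simp [sum_inner, inner_sum, v.inner_eq_ite]
    rw [← inner_self_eq_norm_sq (𝕜 := ℂ)]
    exact (congrArg RCLike.re h).trans (Complex.natCast_re n)
  have h2 : ‖∑ ℓ, v ℓ ⊗ₜ[ℂ] v ℓ‖ = Real.sqrt n := by
    rw [← h1, Real.sqrt_sq (norm_nonneg _)]
  have h3 : 0 < Real.sqrt n := Real.sqrt_pos.2 (by exact_mod_cast hn)
  rw [maxEntangled, norm_smul, h2, Complex.norm_real, Real.norm_eq_abs,
    abs_of_pos (by positivity), one_div, inv_mul_cancel₀ h3.ne']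

theorem UnitaryRep.transposeRep_apply_basis (φ : UnitaryRep Γ V)
    (v : OrthonormalBasis (Fin n) ℂ V) (x : Γ) (b : Fin n) :
    φ.transposeRep v (MulOpposite.op x) (v b) = ∑ c, φ.coeff v x b c • v c := by
  change transpose v.toBasis (φ.toRep x) (v b) = _
  rw [transpose, ← v.coe_toBasis, Matrix.toLin_self]
  refine Finset.sum_congr rfl fun c _ => ?_
  rw [Matrix.transpose_apply, LinearMap.toMatrix_apply, OrthonormalBasis.coe_toBasis_repr_apply,
    OrthonormalBasis.repr_apply_apply, v.coe_toBasis]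
  rfl

end MaxEntangled

/-! ### Decomposition into blocks -/

section Decomposition

universe w

variable {Γ K : Type*} [Group Γ] [Finite Γ] [NormedAddCommGroup K] [InnerProductSpace ℂ K]
  [FiniteDimensional ℂ K]

/-- **Decomposition of a cyclic representation with a tracial vector.** If the vector state of the
cyclic unit vector `ν` is a trace and `J` acts as `-1`, then the representation is a
multiplicity-free sum of blocks `V i ⊗ V i`, in which `ν` is a combination of maximally entangled
states, and the right translations of the orbit of `ν` become the transposes. -/
theorem exists_isotypic_decomposition {J : Γ} {k : ℕ} {V : Fin k → Type w}
    [∀ i, NormedAddCommGroup (V i)] [∀ i, InnerProductSpace ℂ (V i)]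
    {φ : ∀ i, UnitaryRep Γ (V i)} (hφ : IsListOfIrreps J V φ)
    {d : Fin k → ℕ} (v : ∀ i, OrthonormalBasis (Fin (d i)) ℂ (V i))
    (ρ : UnitaryRep Γ K) (hJ : ∀ y, ρ J y = -y) (ν : K) (hν1 : ‖ν‖ = 1)
    (hcyc : Submodule.span ℂ (Set.range fun g => ρ g ν) = ⊤)
    (hν : ∀ g h, inner ℂ ν (ρ (g * h) ν) = inner ℂ ν (ρ (h * g) ν)) :
    ∃ (m : ℕ) (i : Fin m → Fin k)
      (I : K ≃ₗᵢ[ℂ] PiLp 2 fun j : Fin m => V (i j) ⊗[ℂ] V (i j)) (lam : Fin m → ℝ),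
      StrictMono i ∧ (∀ j, 0 < lam j) ∧ ∑ j, lam j ^ 2 = 1 ∧
      (∀ j, I ν j = (lam j : ℂ) • maxEntangled (v (i j))) ∧
      (∀ x y j, I (ρ x y) j = TensorProduct.map ((φ (i j)).toRep x) LinearMap.id (I y j)) ∧
      (∀ x (R : K →ₗ[ℂ] K), (∀ g, R (ρ g ν) = ρ (g * x) ν) → ∀ y j, I (R y) j =
        TensorProduct.map LinearMap.id
          ((φ (i j)).transposeRep (v (i j)) (MulOpposite.op x)) (I y j)) := by
  have := Fintype.ofFinite Γ
  have hd : ∀ i, 0 < d i := by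
    intro i
    have := UnitaryRep.nontrivial_of_isIrreducible (hφ.irreducible i)
    have := (v i).toBasis.index_nonempty
    exact Fin.pos_iff_nonempty.2 this
  have hΓ : 0 < Fintype.card Γ := Fintype.card_pos
  choose r hr0 hr hrν using fun i => exists_norm_isotypicVector (v i) (hφ.irreducible i) hν
  -- The blocks that occur are those whose isotypic vectors do not vanish.
  let s : Finset (Fin k) := Finset.univ.filter fun i => r i ≠ 0
  let i : Fin s.card ↪o Fin k := s.orderEmbOfFin rfl
  have hri : ∀ j, r (i j) ≠ 0 := fun j =>
    (Finset.mem_filter.1 (s.orderEmbOfFin_mem rfl j)).2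
  let t : ∀ i, Fin (d i) → Fin (d i) → K := fun i => isotypicVector (φ i) (v i) ρ ν
  -- `r i` is the common norm of the isotypic vectors of block `i`, so these are unit vectors.
  let u : (Σ j : Fin s.card, Fin (d (i j)) × Fin (d (i j))) → K := fun p =>
    (((r (i p.1))⁻¹ : ℝ) : ℂ) • t (i p.1) p.2.1 p.2.2
  have hu : Orthonormal ℂ u := by
    rw [orthonormal_iff_ite]
    rintro ⟨j, a, b⟩ ⟨j', c, e⟩
    change inner ℂ ((((r (i j))⁻¹ : ℝ) : ℂ) • t (i j) a b)
      ((((r (i j'))⁻¹ : ℝ) : ℂ) • t (i j') c e) = _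
    rw [inner_smul_left, inner_smul_right]
    by_cases hj : j = j'
    · subst hj
      rw [hr]
      have h0 : (r (i j) : ℂ) ≠ 0 := by exact_mod_cast hri j
      by_cases hab : a = c ∧ b = e
      · obtain ⟨rfl, rfl⟩ := hab
        rw [if_pos ⟨rfl, rfl⟩, if_pos rfl, Complex.conj_ofReal]
        push_cast
        field_simp
      · rw [if_neg hab, if_neg, mul_zero, mul_zero]
        intro h
        obtain ⟨-, h⟩ := Sigma.mk.inj_iff.1 h
        exact hab (by simpa using h)
    · rw [if_neg fun h => hj (Sigma.mk.inj_iff.1 h).1,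
        inner_isotypicVector_of_not_equivalent (v (i j)) _ (v (i j')) (hφ.irreducible _)
          (hφ.irreducible _) (hφ.inequivalent _ _ fun h => hj (i.injective h.symm)) hν,
        mul_zero, mul_zero]
  have hspan : ⊤ ≤ Submodule.span ℂ (Set.range u) := by
    rw [← span_isotypicVector_eq_top hφ v hJ hcyc, Submodule.span_le]
    rintro _ ⟨⟨l, a, b⟩, rfl⟩
    change t l a b ∈ Submodule.span ℂ (Set.range u)
    by_cases hl : r l = 0
    · have h0 : t l a b = 0 := by
        rw [← inner_self_eq_zero (𝕜 := ℂ), hr, if_pos ⟨rfl, rfl⟩, hl]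
        simp
      rw [h0]
      exact Submodule.zero_mem _
    · obtain ⟨j, rfl⟩ : ∃ j, i j = l := by
        have : l ∈ Set.range i := by
          rw [Finset.range_orderEmbOfFin]
          exact Finset.mem_coe.2 (Finset.mem_filter.2 ⟨Finset.mem_univ _, hl⟩)
        exact this
      have h0 : (r (i j) : ℂ) ≠ 0 := by exact_mod_cast hl
      have h1 : t (i j) a b = (r (i j) : ℂ) • u ⟨j, a, b⟩ := by
        change _ = (r (i j) : ℂ) • (((r (i j))⁻¹ : ℝ) : ℂ) • t (i j) a b
        rw [Complex.ofReal_inv, smul_inv_smul₀ h0]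
      rw [h1]
      exact Submodule.smul_mem _ _ (Submodule.subset_span ⟨_, rfl⟩)
  let B := OrthonormalBasis.mk hu hspan
  have hB : ∀ p, B p = u p := fun p => by simp [B]
  let C := Pi.orthonormalBasis fun j => (v (i j)).tensorProduct (v (i j))
  let I := B.equiv C (Equiv.refl _)
  have hIu : ∀ j a b, I (u ⟨j, a, b⟩) = PiLp.single 2 j (v (i j) a ⊗ₜ[ℂ] v (i j) b) := by
    intro j a b
    rw [← hB, OrthonormalBasis.equiv_apply_basis, Pi.orthonormalBasis_apply]
    exact congrArg _ (OrthonormalBasis.tensorProduct_apply _ _ a b)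
  -- The coefficient on `v a ⊗ v a` is `⟪t a a, ν⟫ / r = r d / |Γ|`; the factor `√d` undoes the
  -- normalization of `maxEntangled`.
  have hIν : ∀ j, I ν j = ((r (i j) * d (i j) / Fintype.card Γ * Real.sqrt (d (i j)) : ℝ) : ℂ) •
      maxEntangled (v (i j)) := by
    intro j
    have hcoeff : ∀ a b, ((v (i j)).tensorProduct (v (i j))).repr (I ν j) (a, b) =
        if a = b then ((r (i j) * d (i j) / Fintype.card Γ : ℝ) : ℂ) else 0 := by
      intro a b
      have h1 : ((v (i j)).tensorProduct (v (i j))).repr (I ν j) (a, b) =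
          C.repr (I ν) ⟨j, a, b⟩ := rfl
      have h2 : C.repr (I ν) ⟨j, a, b⟩ = inner ℂ (u ⟨j, a, b⟩) ν := by
        rw [OrthonormalBasis.repr_apply_apply, ← hB, ← I.inner_map_map,
          OrthonormalBasis.equiv_apply_basis]
        rfl
      have h0 : (r (i j) : ℂ) ≠ 0 := by exact_mod_cast hri j
      rw [h1, h2, inner_smul_left, hrν, Complex.conj_ofReal]
      split_ifs
      · push_cast
        field_simp
      · rw [mul_zero]
    have hsq : ((Real.sqrt (d (i j)) : ℝ) : ℂ) ≠ 0 := by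
      exact_mod_cast (Real.sqrt_pos.2 (by exact_mod_cast hd (i j))).ne'
    rw [← ((v (i j)).tensorProduct (v (i j))).sum_repr (I ν j), Fintype.sum_prod_type]
    simp_rw [hcoeff, ite_smul, zero_smul]
    simp only [Finset.sum_ite_eq, Finset.mem_univ, if_true, maxEntangled,
      OrthonormalBasis.tensorProduct_apply]
    rw [← Finset.smul_sum, smul_smul]
    congr 1
    push_cast
    field_simp
  refine ⟨s.card, i, I, fun j => r (i j) * d (i j) / Fintype.card Γ * Real.sqrt (d (i j)),
    i.strictMono, fun j => ?_, ?_, hIν, fun x y j => ?_, fun x R hR y j => ?_⟩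
  · have h1 : 0 < r (i j) := lt_of_le_of_ne (hr0 _) (hri j).symm
    have h2 : (0 : ℝ) < d (i j) := by exact_mod_cast hd (i j)
    have h3 : (0 : ℝ) < Fintype.card Γ := by exact_mod_cast hΓ
    positivity
  · have h1 : ‖I ν‖ ^ 2 = 1 := by rw [I.norm_map, hν1, one_pow]
    rw [PiLp.norm_sq_eq_of_L2] at h1
    rw [← h1]
    refine Finset.sum_congr rfl fun j _ => ?_
    rw [hIν, norm_smul, norm_maxEntangled _ (hd _), mul_one, Complex.norm_real, Real.norm_eq_abs,
      sq_abs]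
  · let P : (PiLp 2 fun j : Fin s.card => V (i j) ⊗[ℂ] V (i j)) →ₗ[ℂ] V (i j) ⊗[ℂ] V (i j) :=
      (PiLp.proj 2 (𝕜 := ℂ) (fun j : Fin s.card => V (i j) ⊗[ℂ] V (i j)) j).toLinearMap
    have h : P ∘ₗ I.toLinearEquiv.toLinearMap ∘ₗ (ρ x).toLinearEquiv.toLinearMap =
        TensorProduct.map ((φ (i j)).toRep x) LinearMap.id ∘ₗ P ∘ₗ I.toLinearEquiv.toLinearMap := by
      refine B.toBasis.ext ?_
      rintro ⟨j', a, b⟩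
      rw [OrthonormalBasis.coe_toBasis, hB]
      change I (ρ x (u ⟨j', a, b⟩)) j =
        TensorProduct.map ((φ (i j)).toRep x) LinearMap.id (I (u ⟨j', a, b⟩) j)
      have hx : ρ x (u ⟨j', a, b⟩) = ∑ c, (φ (i j')).coeff (v (i j')) x c a • u ⟨j', c, b⟩ := by
        change ρ x (_ • isotypicVector _ _ ρ ν a b) = ∑ c, _ • _ • isotypicVector _ _ ρ ν c b
        rw [map_smul, rep_isotypicVector, Finset.smul_sum]
        exact Finset.sum_congr rfl fun c _ => smul_comm _ _ _
      rw [hx, map_sum]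
      simp_rw [map_smul, hIu]
      by_cases hj : j = j'
      · subst hj
        simp [(φ (i j)).apply_basis (v (i j)), TensorProduct.sum_tmul, TensorProduct.smul_tmul']
      · simp [hj]
    exact LinearMap.congr_fun h y
  · let P : (PiLp 2 fun j : Fin s.card => V (i j) ⊗[ℂ] V (i j)) →ₗ[ℂ] V (i j) ⊗[ℂ] V (i j) :=
      (PiLp.proj 2 (𝕜 := ℂ) (fun j : Fin s.card => V (i j) ⊗[ℂ] V (i j)) j).toLinearMap
    have h : P ∘ₗ I.toLinearEquiv.toLinearMap ∘ₗ R =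
        TensorProduct.map LinearMap.id ((φ (i j)).transposeRep (v (i j)) (MulOpposite.op x)) ∘ₗ
          P ∘ₗ I.toLinearEquiv.toLinearMap := by
      refine B.toBasis.ext ?_
      rintro ⟨j', a, b⟩
      rw [OrthonormalBasis.coe_toBasis, hB]
      change I (R (u ⟨j', a, b⟩)) j = TensorProduct.map LinearMap.id
        ((φ (i j)).transposeRep (v (i j)) (MulOpposite.op x)) (I (u ⟨j', a, b⟩) j)
      have hx : R (u ⟨j', a, b⟩) = ∑ c, (φ (i j')).coeff (v (i j')) x b c • u ⟨j', a, c⟩ := by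
        change R (_ • isotypicVector _ _ ρ ν a b) = ∑ c, _ • _ • isotypicVector _ _ ρ ν a c
        rw [map_smul, right_isotypicVector _ _ _ _ hR, Finset.smul_sum]
        exact Finset.sum_congr rfl fun c _ => smul_comm _ _ _
      rw [hx, map_sum]
      simp_rw [map_smul, hIu]
      by_cases hj : j = j'
      · subst hj
        simp [UnitaryRep.transposeRep_apply_basis, TensorProduct.tmul_sum]
      · simp [hj]
    exact LinearMap.congr_fun h y

end Decomposition

/-! ### Observables and generators -/

section Observables

variable {H : Type*} [NormedAddCommGroup H] [InnerProductSpace ℂ H] [CompleteSpace H]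

theorem IsObservable.apply_apply {T : H →L[ℂ] H} (hT : IsObservable T) (w : H) : T (T w) = w := by
  have h := Unitary.star_mul_self_of_mem hT.2
  rw [hT.1.star_eq] at h
  exact congrArg (fun A : H →L[ℂ] H => A w) h

theorem IsObservable.inner_apply_left {T : H →L[ℂ] H} (hT : IsObservable T) (x y : H) :
    inner ℂ (T x) y = inner ℂ x (T y) := by
  rw [← ContinuousLinearMap.adjoint_inner_left, ← ContinuousLinearMap.star_eq_adjoint,
    hT.1.star_eq]

theorem IsObservable.norm_apply {T : H →L[ℂ] H} (hT : IsObservable T) (x : H) : ‖T x‖ = ‖x‖ := by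
  rw [← sq_eq_sq₀ (norm_nonneg _) (norm_nonneg _), ← inner_self_eq_norm_sq (𝕜 := ℂ),
    ← inner_self_eq_norm_sq (𝕜 := ℂ), hT.inner_apply_left, hT.apply_apply]

/-- The restriction of an observable to an invariant subspace. -/
def IsObservable.restrict {T : H →L[ℂ] H} (hT : IsObservable T) (N : Submodule ℂ H)
    (hN : ∀ w ∈ N, T w ∈ N) : N ≃ₗᵢ[ℂ] N where
  toFun w := ⟨T w, hN w w.2⟩
  invFun w := ⟨T w, hN w w.2⟩
  map_add' x y := by ext; simp
  map_smul' c x := by ext; simp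
  left_inv x := by ext; exact hT.apply_apply _
  right_inv x := by ext; exact hT.apply_apply _
  norm_map' x := hT.norm_apply x

end Observables

section GroupInduction

variable {α β : Type*} {G : Graph α β} {b : V(G) → ZMod 2}

theorem Gam.induction {P : Gam G b → Prop} (hx : ∀ e, P (Gam.x G b e)) (hJ : P (Gam.J G b))
    (one : P 1) (mul : ∀ g h, P g → P h → P (g * h)) (inv : ∀ g, P g → P g⁻¹) (g : Gam G b) :
    P g := by
  have hg : g ∈ Subgroup.closure
      (Set.range (PresentedGroup.of : Gen G → PresentedGroup {r | IsRelator G b r})) := by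
    rw [PresentedGroup.closure_range_of]
    trivial
  induction hg using Subgroup.closure_induction with
  | mem g hg =>
    obtain ⟨e | _, rfl⟩ := hg
    · exact hx e
    · exact hJ
  | one => exact one
  | mul g h _ _ hg hh => exact mul g h hg hh
  | inv g _ hg => exact inv g hg

end GroupInduction

/-! ### The representation carried by a perfect strategy -/

namespace CommutingOperatorStrategy

variable {α β : Type*} {G : Graph α β} {b : V(G) → ZMod 2}
  {H : Type*} [NormedAddCommGroup H] [InnerProductSpace ℂ H] [CompleteSpace H]
  (S : CommutingOperatorStrategy G b H)

/-- The monoid generated by the first player's observables. -/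
def xMonoid : Submonoid (H →L[ℂ] H) :=
  Submonoid.closure {T | ∃ v e, T = S.X v e}

/-- The span of the orbit of the state under the first player's observables. -/
def cyclicSubspace : Submodule ℂ H :=
  Submodule.span ℂ {w | ∃ T ∈ S.xMonoid, w = T S.ν}

theorem ν_mem : S.ν ∈ S.cyclicSubspace :=
  Submodule.subset_span ⟨1, S.xMonoid.one_mem, rfl⟩

theorem X_mem (v : V(G)) (e : G.incidenceSet v) (w : H) (hw : w ∈ S.cyclicSubspace) :
    S.X v e w ∈ S.cyclicSubspace := by
  induction hw using Submodule.span_induction with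
  | mem w hw =>
    obtain ⟨T, hT, rfl⟩ := hw
    exact Submodule.subset_span
      ⟨S.X v e * T, S.xMonoid.mul_mem (Submonoid.subset_closure ⟨v, e, rfl⟩) hT, rfl⟩
  | zero => rw [map_zero]; exact Submodule.zero_mem _
  | add x y _ _ hx hy => rw [map_add]; exact Submodule.add_mem _ hx hy
  | smul c x _ hx => rw [map_smul]; exact Submodule.smul_mem _ c hx

theorem commute_Y_of_mem (u : V(G)) (f : G.incidenceSet u) {T : H →L[ℂ] H} (hT : T ∈ S.xMonoid) :
    Commute (S.Y u f) T := by
  induction hT using Submonoid.closure_induction with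
  | mem T hT =>
    obtain ⟨v, e, rfl⟩ := hT
    exact (S.commute_X_Y v e u f).symm
  | one => exact Commute.one_right _
  | mul T T' _ _ h h' => exact h.mul_right h'

variable {S}

/-- In a perfect strategy the unit vectors `X ν` and `Y ν` have inner product `1`. -/
theorem IsPerfect.X_ν_eq_Y_ν (hS : S.IsPerfect) (v u : V(G)) (e : β) (hv : e ∈ G.incidenceSet v)
    (hu : e ∈ G.incidenceSet u) : S.X v ⟨e, hv⟩ S.ν = S.Y u ⟨e, hu⟩ S.ν := by
  rw [← inner_eq_one_iff_of_norm_eq_one (𝕜 := ℂ), (S.isObservable_X _ _).inner_apply_left]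
  · exact hS v u e hv hu
  · rw [(S.isObservable_X _ _).norm_apply, S.norm_ν]
  · rw [(S.isObservable_Y _ _).norm_apply, S.norm_ν]

/-- Words in the first player's observables act on the state as operators that commute with all of
the first player's observables, namely as the reversed words of the second player. -/
theorem IsPerfect.exists_commute_of_mem (hS : S.IsPerfect) {T : H →L[ℂ] H} (hT : T ∈ S.xMonoid) :
    ∃ T' : H →L[ℂ] H, (∀ v e, Commute T' (S.X v e)) ∧ T S.ν = T' S.ν := by
  induction hT using Submonoid.closure_induction_left with
  | one => exact ⟨1, fun v e => Commute.one_left _, rfl⟩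
  | mul_left x hx T _ ih =>
    obtain ⟨v, e, rfl⟩ := hx
    obtain ⟨T', hT', h⟩ := ih
    refine ⟨T' * S.Y v e, fun u f => (hT' u f).mul_left (S.commute_X_Y u f v e).symm, ?_⟩
    rw [mul_apply_eq_comp, h, mul_apply_eq_comp,
      ← hS.X_ν_eq_Y_ν v v e.1 e.2 e.2, ← mul_apply_eq_comp,
      ← mul_apply_eq_comp, (hT' v e).eq]

/-- On the cyclic subspace the observables of the two ends of an edge agree. -/
theorem IsPerfect.X_eq_X (hS : S.IsPerfect) (v u : V(G)) (e : β) (hv : e ∈ G.incidenceSet v)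
    (hu : e ∈ G.incidenceSet u) (w : H) (hw : w ∈ S.cyclicSubspace) :
    S.X v ⟨e, hv⟩ w = S.X u ⟨e, hu⟩ w := by
  induction hw using Submodule.span_induction with
  | mem w hw =>
    obtain ⟨T, hT, rfl⟩ := hw
    obtain ⟨T', hT', h⟩ := hS.exists_commute_of_mem hT
    rw [h, ← mul_apply_eq_comp, ← mul_apply_eq_comp, ← (hT' _ _).eq,
      ← (hT' _ _).eq, mul_apply_eq_comp, mul_apply_eq_comp,
      hS.X_ν_eq_Y_ν v v e hv hv, hS.X_ν_eq_Y_ν u v e hu hv]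
  | zero => rw [map_zero, map_zero]
  | add x y _ _ hx hy => rw [map_add, map_add, hx, hy]
  | smul c x _ hx => rw [map_smul, map_smul, hx]

theorem IsPerfect.Y_mem (hS : S.IsPerfect) (v : V(G)) (e : G.incidenceSet v) (w : H)
    (hw : w ∈ S.cyclicSubspace) :
    S.Y v e w ∈ S.cyclicSubspace := by
  induction hw using Submodule.span_induction with
  | mem w hw =>
    obtain ⟨T, hT, rfl⟩ := hw
    refine Submodule.subset_span
      ⟨T * S.X v e, S.xMonoid.mul_mem hT (Submonoid.subset_closure ⟨v, e, rfl⟩), ?_⟩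
    rw [← mul_apply_eq_comp, (S.commute_Y_of_mem v e hT).eq,
      mul_apply_eq_comp, mul_apply_eq_comp,
      hS.X_ν_eq_Y_ν v v e.1 e.2 e.2]
  | zero => rw [map_zero]; exact Submodule.zero_mem _
  | add x y _ _ hx hy => rw [map_add]; exact Submodule.add_mem _ hx hy
  | smul c x _ hx => rw [map_smul]; exact Submodule.smul_mem _ c hx

/-- On the cyclic subspace the first player's observables satisfy the relations of `Γ(G, b)`, with
`J` acting as `-1`. -/
theorem IsPerfect.exists_rep (hS : S.IsPerfect) : ∃ ρ : UnitaryRep (Gam G b) S.cyclicSubspace,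
    (∀ (v : V(G)) (e : G.incidenceSet v) (w : S.cyclicSubspace),
      (ρ (Gam.x G b (incEdge G v e)) w : H) = S.X v e w) ∧
    ∀ w, ρ (Gam.J G b) w = -w := by
  have hend : ∀ e : E(G), ∃ v : V(G), e.1 ∈ G.incidenceSet v := fun e => by
    obtain ⟨x, y, h⟩ := G.exists_isLink_of_mem_edgeSet e.2
    exact ⟨⟨x, h.left_mem⟩, h.inc_left⟩
  choose end₁ hend₁ using hend
  -- The choice of an end of `e` does not matter on the cyclic subspace.
  let gen : Gen G → (S.cyclicSubspace ≃ₗᵢ[ℂ] S.cyclicSubspace)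
    | .x e => (S.isObservable_X (end₁ e) ⟨e, hend₁ e⟩).restrict S.cyclicSubspace (S.X_mem _ _)
    | .J => LinearIsometryEquiv.neg ℂ
  have hgen : ∀ (v : V(G)) (e : G.incidenceSet v) (w : S.cyclicSubspace),
      (gen (.x (incEdge G v e)) w : H) = S.X v e w := fun v e w =>
    hS.X_eq_X _ _ _ _ _ w w.2
  have hgenJ : ∀ w, gen .J w = -w := fun w => rfl
  have hJpow : ∀ (n : ℕ) (w : S.cyclicSubspace),
      ((gen .J ^ n) w : H) = ((-1 : H →L[ℂ] H) ^ n) w := by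
    intro n w
    induction n with
    | zero => rfl
    | succ n ih =>
      rw [pow_succ', pow_succ', LinearIsometryEquiv.coe_mul, Function.comp_apply, hgenJ,
        Submodule.coe_neg, ih, mul_apply_eq_comp]
      rfl
  have hprod : ∀ (v : V(G)) (l : List (G.incidenceSet v)) (w : S.cyclicSubspace),
      ((l.map fun e => gen (.x (incEdge G v e))).prod w : H) = (l.map (S.X v)).prod w := by
    intro v l w
    induction l with
    | nil => rfl
    | cons e l ih =>
      rw [List.map_cons, List.prod_cons, List.map_cons, List.prod_cons,
        mul_apply_eq_comp (S.X v e), ← ih, ← hgen]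
      rfl
  have hrel : ∀ r ∈ {r | IsRelator G b r}, FreeGroup.lift gen r = 1 := by
    rintro r hr
    cases hr with
    | J_sq =>
      rw [map_pow, FreeGroup.lift_apply_of, sq]
      ext w
      change ((gen .J (gen .J w) : S.cyclicSubspace) : H) = w
      rw [hgenJ, hgenJ, neg_neg]
    | x_sq e =>
      rw [map_pow, FreeGroup.lift_apply_of, sq]
      ext w
      exact (S.isObservable_X _ _).apply_apply _
    | comm_J e =>
      rw [map_commutatorElement, FreeGroup.lift_apply_of, FreeGroup.lift_apply_of,
        commutatorElement_eq_one_iff_mul_comm]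
      ext w
      change ((gen (.x e) (gen .J w) : S.cyclicSubspace) : H) = (gen .J (gen (.x e) w) : H)
      rw [hgenJ, hgenJ, map_neg]
    | comm_vertex v e f =>
      rw [map_commutatorElement, FreeGroup.lift_apply_of, FreeGroup.lift_apply_of,
        commutatorElement_eq_one_iff_mul_comm]
      ext w
      change ((gen (.x (incEdge G v e)) (gen (.x (incEdge G v f)) w) : S.cyclicSubspace) : H) =
        (gen (.x (incEdge G v f)) (gen (.x (incEdge G v e)) w) : H)
      rw [hgen, hgen, hgen, hgen, ← mul_apply_eq_comp, (S.commute_X v e f).eq]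
      rfl
    | vertex v l hl =>
      rw [map_mul, map_inv, map_pow, FreeGroup.lift_apply_of, mul_inv_eq_one, map_list_prod,
        List.map_map]
      ext w
      rw [hJpow, ← S.prod_X v l hl, ← hprod]
      congr 4
  refine ⟨PresentedGroup.toGroup hrel, fun v e w => ?_, fun w => ?_⟩
  · rw [← hgen, Gam.x, PresentedGroup.toGroup.of]
  · rw [← hgenJ, Gam.J, PresentedGroup.toGroup.of]

/-- The state is a cyclic vector for the representation on the cyclic subspace. -/
theorem span_orbit_eq_top {ρ : UnitaryRep (Gam G b) S.cyclicSubspace}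
    (hρ : ∀ (v : V(G)) (e : G.incidenceSet v) (w : S.cyclicSubspace),
      (ρ (Gam.x G b (incEdge G v e)) w : H) = S.X v e w) :
    Submodule.span ℂ (Set.range fun g => ρ g ⟨S.ν, S.ν_mem⟩) = ⊤ := by
  have hword : ∀ T ∈ S.xMonoid, ∃ g, T S.ν = ρ g ⟨S.ν, S.ν_mem⟩ := by
    intro T hT
    induction hT using Submonoid.closure_induction_left with
    | one => exact ⟨1, by simp⟩
    | mul_left x hx T _ ih =>
      obtain ⟨v, e, rfl⟩ := hx
      obtain ⟨g, hg⟩ := ih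
      exact ⟨Gam.x G b (incEdge G v e) * g, by
        rw [UnitaryRep.mul_apply, hρ, ← hg, mul_apply_eq_comp]⟩
  have hle : S.cyclicSubspace ≤ (Submodule.span ℂ
      (Set.range fun g => ρ g ⟨S.ν, S.ν_mem⟩)).map S.cyclicSubspace.subtype := by
    refine Submodule.span_le.2 ?_
    rintro _ ⟨T, hT, rfl⟩
    obtain ⟨g, hg⟩ := hword T hT
    exact ⟨_, Submodule.subset_span ⟨g, rfl⟩, hg.symm⟩
  rw [eq_top_iff]
  intro w _
  obtain ⟨w', hw', h⟩ := hle w.2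
  rwa [← Subtype.ext h]

/-- The second player's observable, restricted to the cyclic subspace. -/
def IsPerfect.restrictY (hS : S.IsPerfect) (u : V(G)) (f : G.incidenceSet u) :
    S.cyclicSubspace →ₗ[ℂ] S.cyclicSubspace :=
  (S.Y u f).toLinearMap.restrict (hS.Y_mem u f)

theorem IsPerfect.inner_restrictY_left (hS : S.IsPerfect) (u : V(G)) (f : G.incidenceSet u)
    (w w' : S.cyclicSubspace) :
    inner ℂ (hS.restrictY u f w) w' = inner ℂ w (hS.restrictY u f w') :=
  (S.isObservable_Y u f).inner_apply_left w w'

theorem IsPerfect.rep_x_ν (hS : S.IsPerfect) {ρ : UnitaryRep (Gam G b) S.cyclicSubspace}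
    (hρ : ∀ (v : V(G)) (e : G.incidenceSet v) (w : S.cyclicSubspace),
      (ρ (Gam.x G b (incEdge G v e)) w : H) = S.X v e w) (u : V(G)) (f : G.incidenceSet u) :
    ρ (Gam.x G b (incEdge G u f)) ⟨S.ν, S.ν_mem⟩ = hS.restrictY u f ⟨S.ν, S.ν_mem⟩ :=
  Subtype.ext ((hρ u f _).trans (hS.X_ν_eq_Y_ν u u f.1 f.2 f.2))

theorem IsPerfect.restrictY_rep_apply (hS : S.IsPerfect) {ρ : UnitaryRep (Gam G b) S.cyclicSubspace}
    (hρ : ∀ (v : V(G)) (e : G.incidenceSet v) (w : S.cyclicSubspace),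
      (ρ (Gam.x G b (incEdge G v e)) w : H) = S.X v e w)
    (hJ : ∀ w, ρ (Gam.J G b) w = -w) (u : V(G)) (f : G.incidenceSet u) (g : Gam G b) :
    ∀ w, hS.restrictY u f (ρ g w) = ρ g (hS.restrictY u f w) := by
  induction g using Gam.induction with
  | hx e =>
    intro w
    obtain ⟨x, y, h⟩ := G.exists_isLink_of_mem_edgeSet e.2
    have hx := hρ ⟨x, h.left_mem⟩ ⟨e, h.inc_left⟩
    change ∀ w, (ρ (Gam.x G b e) w : H) = _ at hx
    ext
    change S.Y u f (ρ (Gam.x G b e) w) = _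
    rw [hx, hx, ← mul_apply_eq_comp, ← (S.commute_X_Y _ _ _ _).eq]
    rfl
  | hJ => intro w; rw [hJ, hJ, map_neg]
  | one => intro w; simp
  | mul g h hg hh => intro w; rw [UnitaryRep.mul_apply, UnitaryRep.mul_apply, hg, hh]
  | inv g hg =>
    intro w
    apply (ρ g).injective
    rw [← hg, ← UnitaryRep.mul_apply, ← UnitaryRep.mul_apply]
    simp

/-- The vector state of `ν` is a trace: moving the generator `x_e` from one end of a word to the
other is moving it through the second player's observable. -/
theorem IsPerfect.inner_rep_mul_comm (hS : S.IsPerfect) {ρ : UnitaryRep (Gam G b) S.cyclicSubspace}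
    (hρ : ∀ (v : V(G)) (e : G.incidenceSet v) (w : S.cyclicSubspace),
      (ρ (Gam.x G b (incEdge G v e)) w : H) = S.X v e w)
    (hJ : ∀ w, ρ (Gam.J G b) w = -w) (g : Gam G b) :
    ∀ h, inner ℂ ⟨S.ν, S.ν_mem⟩ (ρ (g * h) ⟨S.ν, S.ν_mem⟩) =
      inner ℂ ⟨S.ν, S.ν_mem⟩ (ρ (h * g) ⟨S.ν, S.ν_mem⟩) := by
  set ν₀ : S.cyclicSubspace := ⟨S.ν, S.ν_mem⟩
  induction g using Gam.induction with
  | hx e =>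
    intro h
    obtain ⟨x, y, hxy⟩ := G.exists_isLink_of_mem_edgeSet e.2
    let u : V(G) := ⟨x, hxy.left_mem⟩
    let f : G.incidenceSet u := ⟨e, hxy.inc_left⟩
    have hinv : (Gam.x G b e)⁻¹ = Gam.x G b e := by
      have h2 : Gam.x G b e ^ 2 = 1 :=
        (QuotientGroup.eq_one_iff _).2 (Subgroup.subset_normalClosure (IsRelator.x_sq e))
      rw [inv_eq_iff_mul_eq_one, ← sq, h2]
    have hY : ρ (Gam.x G b e) ν₀ = hS.restrictY u f ν₀ := hS.rep_x_ν hρ u f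
    rw [UnitaryRep.mul_apply, UnitaryRep.mul_apply, hY, ← hS.restrictY_rep_apply hρ hJ,
      ← hS.inner_restrictY_left, ← hY, UnitaryRep.inner_apply_left, hinv]
  | hJ => intro h; rw [UnitaryRep.mul_apply, UnitaryRep.mul_apply, hJ, hJ, map_neg]
  | one => intro h; rw [one_mul, mul_one]
  | mul g g' hg hg' => intro h; rw [mul_assoc, hg, mul_assoc, hg', mul_assoc]
  | inv g hg => intro h; simpa [mul_assoc] using (hg (g⁻¹ * h * g⁻¹)).symm

end CommutingOperatorStrategy

end GraphIncidence

open GraphIncidence in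
theorem corollary2p6 {α β : Type*} (G : Graph α β) [G.Loopless]
    (hVfin : V(G).Finite) (hEfin : E(G).Finite) (b : V(G) → ZMod 2)
    (hfin : Finite (Gam G b))
    {k : ℕ} (V : Fin k → Type*) [∀ i, NormedAddCommGroup (V i)]
    [∀ i, InnerProductSpace ℂ (V i)] (φ : ∀ i, UnitaryRep (Gam G b) (V i))
    (hφ : IsListOfIrreps (Gam.J G b) V φ)
    (d : Fin k → ℕ) (v : ∀ i, OrthonormalBasis (Fin (d i)) ℂ (V i))
    {H : Type*} [NormedAddCommGroup H] [InnerProductSpace ℂ H] [CompleteSpace H]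
    (S : CommutingOperatorStrategy G b H) (hS : S.IsPerfect) :
    ∃ (H₀ : Submodule ℂ H) (hν : S.ν ∈ H₀)
      (hX : ∀ (u : V(G)) (e : G.incidenceSet u), ∀ w ∈ H₀, S.X u e w ∈ H₀)
      (hY : ∀ (u : V(G)) (e : G.incidenceSet u), ∀ w ∈ H₀, S.Y u e w ∈ H₀)
      (m : ℕ) (i : Fin m → Fin k)
      (I : H₀ ≃ₗᵢ[ℂ] PiLp 2 fun j : Fin m => V (i j) ⊗[ℂ] V (i j))
      (lam : Fin m → ℝ),
      FiniteDimensional ℂ H₀ ∧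
      StrictMono i ∧
      (∀ j, 0 < lam j) ∧
      ∑ j, lam j ^ 2 = 1 ∧
      (∀ j, I ⟨S.ν, hν⟩ j = (lam j : ℂ) • maxEntangled (v (i j))) ∧
      (∀ (u : V(G)) (e : G.incidenceSet u)
        (ξ : PiLp 2 fun j : Fin m => V (i j) ⊗[ℂ] V (i j)) (j : Fin m),
        I ⟨S.X u e (I.symm ξ), hX u e _ (I.symm ξ).2⟩ j =
          TensorProduct.map ((φ (i j)).toRep (Gam.x G b (incEdge G u e))) LinearMap.id (ξ j)) ∧
      (∀ (u : V(G)) (e : G.incidenceSet u)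
        (ξ : PiLp 2 fun j : Fin m => V (i j) ⊗[ℂ] V (i j)) (j : Fin m),
        I ⟨S.Y u e (I.symm ξ), hY u e _ (I.symm ξ).2⟩ j =
          TensorProduct.map LinearMap.id
            ((φ (i j)).transposeRep (v (i j)) (MulOpposite.op (Gam.x G b (incEdge G u e))))
            (ξ j)) := by
  obtain ⟨ρ, hρ, hJ⟩ := hS.exists_rep
  let ν₀ : S.cyclicSubspace := ⟨S.ν, S.ν_mem⟩
  have hcyc : Submodule.span ℂ (Set.range fun g => ρ g ν₀) = ⊤ :=
    CommutingOperatorStrategy.span_orbit_eq_top hρ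
  have hfd : FiniteDimensional ℂ S.cyclicSubspace :=
    ⟨hcyc ▸ Submodule.fg_span (Set.finite_range _)⟩
  obtain ⟨m, i, I, lam, hi, hlam, hsum, hν, hX, hY⟩ :=
    exists_isotypic_decomposition hφ v ρ hJ ν₀ S.norm_ν hcyc (hS.inner_rep_mul_comm hρ hJ)
  refine ⟨S.cyclicSubspace, S.ν_mem, S.X_mem, hS.Y_mem, m, i, I, lam, hfd, hi, hlam, hsum, hν,
    fun u e ξ j => ?_, fun u e ξ j => ?_⟩
  · have h := hX (Gam.x G b (incEdge G u e)) (I.symm ξ) j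
    rw [I.apply_symm_apply] at h
    have hXρ : (⟨S.X u e (I.symm ξ), S.X_mem u e _ (I.symm ξ).2⟩ : S.cyclicSubspace) =
        ρ (Gam.x G b (incEdge G u e)) (I.symm ξ) := Subtype.ext (hρ u e _).symm
    rw [hXρ]
    exact h
  · have h := hY (Gam.x G b (incEdge G u e)) (hS.restrictY u e)
      (fun g => by rw [hS.restrictY_rep_apply hρ hJ, UnitaryRep.mul_apply, hS.rep_x_ν hρ])
      (I.symm ξ) j
    rw [I.apply_symm_apply] at h
    exact h
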